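/- Let $n\ge 1$ be an integer, let $K$ be an algebraically closed field (of any characteristic), and let $\mathbb G_m^n=(K\setminus\{0\})^n$ with coordinatewise multiplication. Let $X\subset\mathbb G_m^n$ be an algebraic subset, that is, the set of common zeros in $\mathbb G_m^n$ of finitely many Laurent polynomials in $K[X_1^{\pm1},\dots,X_n^{\pm1}]$, and suppose that $X$ has dimension $d$ (the Krull dimension of its coordinate ring $K[X_1^{\pm1},\dots,X_n^{\pm1}]/I(X)$, where $I(X)$ is the ideal of all Laurent polynomials vanishing on $X$), $d\ge 0$. For a real number $T\ge1$ let $$X_T=\{\boldsymbol\zeta\in X:\ \boldsymbol\zeta \text{ has finite order in } \mathbb G_m^n \text{ and } \mathrm{ord}(\boldsymbol\zeta)\le T\}.$$ Then there is a constant $C$, depending only on $X$, such that for all real $T\ge 1$ the set $X_T$ is finite and $\#X_T\le C\,T^{d+1}$. -/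

import Mathlib

namespace TorusTorsion

/-- The group of `K`-points of the `n`-dimensional algebraic torus, `(K \ {0})ⁿ`. -/
abbrev Torus (K : Type*) [Field K] (n : ℕ) : Type _ := Fin n → Kˣ

/-- The ring of Laurent polynomials in `n` variables over `K`, realised as the group algebra
of `ℤⁿ`: the basis element at `a` is the monomial `X₁ ^ a₁ ⋯ Xₙ ^ aₙ`. -/
abbrev Laurent (K : Type*) [Field K] (n : ℕ) : Type _ := AddMonoidAlgebra K (Fin n → ℤ)

/-- For a point `x` of the torus, the character `a ↦ x₁ ^ a₁ ⋯ xₙ ^ aₙ` of `ℤⁿ`. -/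
def monomialAt {K : Type*} [Field K] {n : ℕ} (x : Torus K n) :
    Multiplicative (Fin n → ℤ) →* K where
  toFun a := ∏ i, ((x i ^ (Multiplicative.toAdd a i) : Kˣ) : K)
  map_one' := by simp
  map_mul' a b := by simp [zpow_add, Finset.prod_mul_distrib]

/-- Evaluation of Laurent polynomials at a point of the torus. -/
noncomputable def evalAt {K : Type*} [Field K] {n : ℕ} (x : Torus K n) : Laurent K n →ₐ[K] K :=
  AddMonoidAlgebra.lift K K (Fin n → ℤ) (monomialAt x)

/-- A set of points of the torus is algebraic if it is the set of common zeros of finitely many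
Laurent polynomials. -/
def IsAlgebraic {K : Type*} [Field K] {n : ℕ} (X : Set (Torus K n)) : Prop :=
  ∃ S : Finset (Laurent K n), X = {x | ∀ P ∈ S, evalAt x P = 0}

/-- The ideal of all Laurent polynomials that vanish on `X`. -/
noncomputable def vanishingIdeal {K : Type*} [Field K] {n : ℕ} (X : Set (Torus K n)) :
    Ideal (Laurent K n) :=
  ⨅ x ∈ X, RingHom.ker (evalAt x)

/-- The dimension of `X`: the Krull dimension of its coordinate ring
(`⊥` for the empty set, whose coordinate ring is zero). -/
noncomputable def dim {K : Type*} [Field K] {n : ℕ} (X : Set (Torus K n)) : WithBot ℕ∞ :=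
  ringKrullDim (Laurent K n ⧸ vanishingIdeal X)

/-- The set of torsion points in `X` of order at most `T`. -/
def torsionUpTo {K : Type*} [Field K] {n : ℕ} (X : Set (Torus K n)) (T : ℝ) :
    Set (Torus K n) :=
  {ζ | ζ ∈ X ∧ IsOfFinOrder ζ ∧ (orderOf ζ : ℝ) ≤ T}

end TorusTorsion

/-!
By Noether normalization, the powers `V ^ m` of a finite-dimensional subspace `V` of a finitely
generated algebra `A` of Krull dimension `d` have dimension `O(m ^ d)`: if `A = R * E` with `R` the
image of a polynomial ring in at most `d` variables and `E` finite-dimensional, then `V * E ≤ W * E`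
for the image `W` of the polynomials of some bounded degree, so that `V ^ m ≤ W ^ (m + 1) * E`.

Take for `A` the coordinate ring of `X` and for `V` the span of `1` and the coordinates. Distinct
points of `X` of order dividing `N` give distinct characters of the monoid of monomials, and such
characters are linearly independent (Dedekind). On these points exponents only matter modulo `N`, so
the evaluation functionals are already independent on `V ^ (n * N)`; hence `X` contains `O(N ^ d)`
such points. Sum over `N ≤ T`.
-/

namespace TorusTorsion

section Growth

open MvPolynomial

theorem ringKrullDim_le_of_isIntegral {R S : Type*} [CommRing R] [CommRing S] [Algebra R S]
    [FaithfulSMul R S] [Algebra.IsIntegral R S] : ringKrullDim R ≤ ringKrullDim S := by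
  refine iSup_le fun l => ?_
  obtain ⟨Q, hQ⟩ := Algebra.IsIntegral.comap_surjective R S l.head
  have : Q.asIdeal.LiesOver l.head.asIdeal := ⟨congrArg PrimeSpectrum.asIdeal hQ.symm⟩
  obtain ⟨L, hL, -⟩ := Ideal.exists_ltSeries_of_hasGoingUp l Q.asIdeal
  exact hL ▸ Order.LTSeries.length_le_krullDim L

theorem exists_finite_mvPolynomial_algHom {k A : Type*} [Field k] [CommRing A] [Nontrivial A]
    [Algebra k A] [Algebra.FiniteType k A] {d : ℕ} (hd : ringKrullDim A ≤ d) :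
    ∃ s ≤ d, ∃ g : MvPolynomial (Fin s) k →ₐ[k] A, g.Finite := by
  obtain ⟨s, g, hinj, hfin⟩ := exists_finite_inj_algHom_of_fg k A
  refine ⟨s, ?_, g, hfin⟩
  let := g.toRingHom.toAlgebra
  have : Module.Finite (MvPolynomial (Fin s) k) A := hfin
  have : FaithfulSMul (MvPolynomial (Fin s) k) A :=
    (faithfulSMul_iff_algebraMap_injective _ _).2 hinj
  have h : ringKrullDim (MvPolynomial (Fin s) k) ≤ d := ringKrullDim_le_of_isIntegral.trans hd
  simpa [MvPolynomial.ringKrullDim_of_isNoetherianRing, ringKrullDim_eq_zero_of_field] using h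

theorem finrank_mul_le {k A : Type*} [Field k] [Ring A] [Algebra k A]
    (P Q : Submodule k A) [FiniteDimensional k P] [FiniteDimensional k Q] :
    Module.finrank k ↥(P * Q) ≤ Module.finrank k P * Module.finrank k Q := by
  rw [← Module.finrank_tensorProduct, ← Submodule.mulMap_range]
  exact LinearMap.finrank_range_le _

theorem finrank_restrictDegree (σ R : Type*) [Finite σ] [CommRing R] [Nontrivial R] (m : ℕ) :
    Module.finrank R (restrictDegree σ R m) = (m + 1) ^ Nat.card σ := by
  let e : {a : σ →₀ ℕ | ∀ i, a i ≤ m} ≃ (σ → Fin (m + 1)) :=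
    (Finsupp.equivFunOnFinite.subtypeEquiv (q := fun a => ∀ i, a i ≤ m) fun _ => .rfl).trans <|
      Equiv.subtypePiEquivPi.trans (Equiv.piCongrRight fun _ =>
        (Fin.equivSubtype.trans (Equiv.subtypeEquivRight fun _ => Nat.lt_succ_iff)).symm)
  rw [restrictDegree, Module.finrank_eq_nat_card_basis (basisRestrictSupport R _),
    Nat.card_congr e]
  simp [Nat.card_fun]

open scoped Pointwise in
theorem restrictDegree_pow_le (σ R : Type*) [CommSemiring R] (D m : ℕ) :
    restrictDegree σ R D ^ m ≤ restrictDegree σ R (m * D) := by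
  rw [restrictDegree, ← restrictSupport_nsmul]
  refine restrictSupport_mono R ?_
  induction m with
  | zero => simp
  | succ m ih =>
    rw [succ_nsmul]
    refine (Set.add_subset_add_right ih).trans (Set.add_subset_iff.2 fun a ha b hb i => ?_)
    exact (add_le_add (ha i) (hb i)).trans_eq (by ring)

theorem monotone_restrictDegree (σ R : Type*) [CommSemiring R] :
    Monotone (restrictDegree σ R) := fun _ _ h =>
  restrictSupport_mono R fun _ ha i => (ha i).trans h

theorem iSup_restrictDegree (σ R : Type*) [CommSemiring R] :
    ⨆ m, restrictDegree σ R m = ⊤ :=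
  eq_top_iff.2 fun p _ => Submodule.mem_iSup_of_mem p.totalDegree <|
    restrictTotalDegree_le_restrictDegree σ R _ <|
      (mem_restrictTotalDegree σ _ p).2 le_rfl

theorem exists_le_of_fg_of_iSup_eq_top {R M : Type*} [Semiring R] [AddCommMonoid M] [Module R M]
    {V : Submodule R M} (hV : V.FG) {U : ℕ → Submodule R M} (hU : Monotone U)
    (htop : ⨆ m, U m = ⊤) : ∃ m, V ≤ U m := by
  obtain ⟨_, ⟨m, rfl⟩, hm⟩ := (Submodule.fg_iff_compact V).1 hV (Set.range U) _
    (Set.range_nonempty U) hU.directed_le.directedOn_range isLUB_iSup (htop ▸ le_top)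
  exact ⟨m, hm⟩

theorem exists_fg_range_mul_eq_top {k R A : Type*} [CommRing k] [CommRing R] [CommRing A]
    [Algebra k R] [Algebra k A] {g : R →ₐ[k] A} (hg : g.Finite) :
    ∃ E : Submodule k A, E.FG ∧ LinearMap.range g.toLinearMap * E = ⊤ := by
  algebraize [g.toRingHom]
  have : Module.Finite R A := hg
  have : IsScalarTower k R A := .of_algebraMap_eq fun c => (g.commutes c).symm
  obtain ⟨t, ht⟩ := Module.Finite.fg_top (R := R) (M := A)
  refine ⟨Submodule.span k t, Submodule.fg_span t.finite_toSet, ?_⟩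
  have h := Submodule.span_smul_of_span_eq_top (R := k) (Submodule.span_univ (M := R)) (t : Set A)
  rw [ht, Submodule.restrictScalars_top] at h
  rw [eq_top_iff, ← h, Submodule.span_le, Set.smul_subset_iff]
  intro p _ y hy
  rw [Algebra.smul_def]
  exact Submodule.mul_mem_mul ⟨p, rfl⟩ (Submodule.subset_span hy)

theorem pow_le_pow_mul_of_mul_le {α : Type*} [CommMonoid α] [Preorder α] [MulLeftMono α]
    {v w e : α} (hone : 1 ≤ w * e) (h : v * e ≤ w * e) (m : ℕ) : v ^ m ≤ w ^ (m + 1) * e := by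
  induction m with
  | zero => simpa using hone
  | succ m ih =>
    calc v ^ (m + 1) = v * v ^ m := pow_succ' v m
      _ ≤ v * (w ^ (m + 1) * e) := by gcongr
      _ = w ^ (m + 1) * (v * e) := by ac_rfl
      _ ≤ w ^ (m + 1) * (w * e) := by gcongr
      _ = w ^ (m + 1 + 1) * e := by rw [pow_succ _ (m + 1), mul_assoc]

theorem exists_finrank_pow_le_of_finite {σ k A : Type*} [Finite σ] [Field k] [CommRing A]
    [Algebra k A] {g : MvPolynomial σ k →ₐ[k] A} (hg : g.Finite) {V : Submodule k A} (hV : V.FG) :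
    ∃ C : ℕ, ∀ m : ℕ, Module.finrank k ↥(V ^ m) ≤ C * (m + 1) ^ Nat.card σ := by
  obtain ⟨E, hE, htop⟩ := exists_fg_range_mul_eq_top hg
  let U (D : ℕ) : Submodule k A := (restrictDegree σ k D).map g.toLinearMap
  obtain ⟨D, hD⟩ : ∃ D, 1 ⊔ V * E ≤ U D * E := by
    have hone : (1 : Submodule k A).FG := pow_zero V ▸ hV.pow 0
    refine exists_le_of_fg_of_iSup_eq_top (hone.sup (hV.mul hE))
      (fun D D' h => mul_le_mul_left (Submodule.map_mono (monotone_restrictDegree σ k h)) E) ?_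
    rw [← Submodule.iSup_mul, ← Submodule.map_iSup, iSup_restrictDegree, Submodule.map_top, htop]
  obtain ⟨hone, hmul⟩ := sup_le_iff.1 hD
  have hle (m : ℕ) : V ^ m ≤ U ((m + 1) * D) * E :=
    calc V ^ m ≤ U D ^ (m + 1) * E := pow_le_pow_mul_of_mul_le hone hmul m
      _ ≤ U ((m + 1) * D) * E := by
        gcongr
        rw [← Submodule.map_pow]
        exact Submodule.map_mono (restrictDegree_pow_le σ k D (m + 1))
  have hfinE : FiniteDimensional k E := .of_fg hE
  refine ⟨(D + 1) ^ Nat.card σ * Module.finrank k E, fun m => ?_⟩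
  have hfin : FiniteDimensional k ↥(U ((m + 1) * D) * E) :=
    .of_fg ((Module.Finite.iff_fg.1 inferInstance).mul hE)
  calc Module.finrank k ↥(V ^ m) ≤ Module.finrank k ↥(U ((m + 1) * D) * E) :=
        Submodule.finrank_mono (hle m)
    _ ≤ Module.finrank k (U ((m + 1) * D)) * Module.finrank k E := finrank_mul_le _ _
    _ ≤ ((m + 1) * D + 1) ^ Nat.card σ * Module.finrank k E := by
        gcongr
        exact (Submodule.finrank_map_le _ _).trans_eq (finrank_restrictDegree σ k _)
    _ ≤ ((D + 1) * (m + 1)) ^ Nat.card σ * Module.finrank k E := by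
        gcongr
        nlinarith
    _ = (D + 1) ^ Nat.card σ * Module.finrank k E * (m + 1) ^ Nat.card σ := by
        rw [mul_pow]
        ring

theorem exists_finrank_pow_le {k A : Type*} [Field k] [CommRing A] [Algebra k A]
    [Algebra.FiniteType k A] {d : ℕ} (hd : ringKrullDim A ≤ d) {V : Submodule k A} (hV : V.FG) :
    ∃ C : ℕ, ∀ m : ℕ, Module.finrank k ↥(V ^ m) ≤ C * (m + 1) ^ d := by
  cases subsingleton_or_nontrivial A
  · exact ⟨0, fun m => by simp [Module.finrank_zero_of_subsingleton]⟩
  obtain ⟨s, hs, g, hg⟩ := exists_finite_mvPolynomial_algHom (k := k) hd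
  obtain ⟨C, hC⟩ := exists_finrank_pow_le_of_finite hg hV
  refine ⟨C, fun m => (hC m).trans ?_⟩
  rw [Nat.card_fin]
  gcongr
  omega

end Growth

section Points

theorem linearIndependent_of_forall_exists_apply_eq {G k W ι : Type*} [Monoid G] [CommRing k]
    [IsDomain k] [AddCommGroup W] [Module k W] {χ : ι → G →* k} (hχ : Function.Injective χ)
    {f : ι → Module.Dual k W} (hf : ∀ a, ∃ w, ∀ i, f i w = χ i a) : LinearIndependent k f := by
  choose w hw using hf
  refine .of_comp (LinearMap.pi fun a => Module.Dual.eval k W (w a)) ?_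
  have h : LinearIndependent k fun i => (χ i : G → k) :=
    (linearIndependent_monoidHom G k).comp χ hχ
  convert! h using 2 with i
  ext a
  simp [hw]

section MonomialChar

variable {σ k : Type*} [CommSemiring k]

/-- The evaluation of monomials at a point `z` of affine space, as a character of the monoid of
monomials (written multiplicatively, so that Dedekind's lemma applies). -/
noncomputable def monomialChar (z : σ → k) : Multiplicative (σ →₀ ℕ) →* k :=
  (MvPolynomial.eval z : MvPolynomial σ k →* k).comp (MvPolynomial.monomialOneHom k σ)

theorem monomialChar_apply (z : σ → k) (a : Multiplicative (σ →₀ ℕ)) :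
    monomialChar z a = a.toAdd.prod fun i e => z i ^ e :=
  MvPolynomial.eval_monomial.trans (one_mul _)

theorem monomialChar_injective : Function.Injective (monomialChar (σ := σ) (k := k)) := by
  intro z z' h
  funext i
  simpa [monomialChar_apply] using DFunLike.congr_fun h (.ofAdd (Finsupp.single i 1))

end MonomialChar

theorem prod_pow_mem_pow {k A ι : Type*} [CommSemiring k] [CommSemiring A] [Algebra k A]
    [Fintype ι] {V : Submodule k A} (hone : 1 ≤ V) {x : ι → A} (hx : ∀ i, x i ∈ V) {N : ℕ}
    {a : ι → ℕ} (ha : ∀ i, a i ≤ N) : ∏ i, x i ^ a i ∈ V ^ (Fintype.card ι * N) := by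
  have hmem i : x i ^ a i ∈ V ^ N :=
    pow_le_pow_right₀ hone (ha i) (Submodule.pow_mem_pow V (hx i) _)
  rw [← Submodule.span_singleton_le_iff_mem, ← Submodule.prod_span_singleton, mul_comm, pow_mul,
    Fintype.card, ← Finset.prod_const]
  exact Finset.prod_le_prod' fun i _ => (Submodule.span_singleton_le_iff_mem _ _).2 (hmem i)

/-- The points with coordinates of order dividing `N` in the image of `(Spec A)(k)` under the map
to affine space given by `x`. -/
def torsionValues (k : Type*) {A ι : Type*} [CommSemiring k] [Semiring A] [Algebra k A] (x : ι → A)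
    (N : ℕ) : Set (ι → k) :=
  {z | z ^ N = 1 ∧ ∃ φ : A →ₐ[k] k, ∀ i, φ (x i) = z i}

variable {k A ι : Type*} [Field k] [CommRing A] [Algebra k A]

theorem finite_torsionValues_and_ncard_le [Fintype ι] {V : Submodule k A} (hV : V.FG)
    (hone : 1 ≤ V) {x : ι → A} (hx : ∀ i, x i ∈ V) {N : ℕ} (hN : 0 < N) :
    (torsionValues k x N).Finite ∧ (torsionValues k x N).ncard ≤
      Module.finrank k ↥(V ^ (Fintype.card ι * N)) := by
  have hfin : FiniteDimensional k ↥(V ^ (Fintype.card ι * N)) := .of_fg (hV.pow _)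
  choose φ hφ using fun z : torsionValues k x N => z.2.2
  have hli : LinearIndependent k fun z : torsionValues k x N =>
      ((φ z).toLinearMap.domRestrict (V ^ (Fintype.card ι * N)) : Module.Dual k _) := by
    refine linearIndependent_of_forall_exists_apply_eq
      (monomialChar_injective.comp Subtype.val_injective) fun a =>
        ⟨⟨_, prod_pow_mem_pow hone hx fun i => (Nat.mod_lt (a.toAdd i) hN).le⟩, fun z => ?_⟩
    have hz i : z.1 i ^ N = 1 := congrFun z.2.1 i
    simp [monomialChar_apply, Finsupp.prod_fintype, hφ, ← pow_eq_pow_mod _ (hz _)]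
  have := hli.finite
  have := Fintype.ofFinite (torsionValues k x N)
  refine ⟨Set.toFinite _, ?_⟩
  rw [← Nat.card_coe_set_eq, Nat.card_eq_fintype_card, ← Subspace.dual_finrank_eq]
  exact hli.fintype_card_le_finrank

theorem exists_ncard_torsionValues_le [Finite ι] [Algebra.FiniteType k A] {d : ℕ}
    (hd : ringKrullDim A ≤ d) (x : ι → A) :
    ∃ C : ℕ, ∀ N > 0, (torsionValues k x N).Finite ∧ (torsionValues k x N).ncard ≤ C * N ^ d := by
  have := Fintype.ofFinite ι
  let V : Submodule k A := Submodule.span k (insert 1 (Set.range x))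
  have hV : V.FG := Submodule.fg_span ((Set.finite_range x).insert 1)
  have hone : 1 ≤ V := Submodule.one_le.2 (Submodule.subset_span (Set.mem_insert _ _))
  have hx i : x i ∈ V := Submodule.subset_span (Set.mem_insert_of_mem _ ⟨i, rfl⟩)
  obtain ⟨C, hC⟩ := exists_finrank_pow_le hd hV
  refine ⟨C * (Fintype.card ι + 1) ^ d, fun N hN => ?_⟩
  obtain ⟨hfin, hcard⟩ := finite_torsionValues_and_ncard_le hV hone hx hN
  refine ⟨hfin, ?_⟩
  calc (torsionValues k x N).ncard ≤ C * (Fintype.card ι * N + 1) ^ d := hcard.trans (hC _)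
    _ ≤ C * ((Fintype.card ι + 1) * N) ^ d := by
        gcongr
        nlinarith
    _ = C * (Fintype.card ι + 1) ^ d * N ^ d := by rw [mul_pow, mul_assoc]

end Points

theorem finite_orderOf_le_and_ncard_le {G : Type*} [Monoid G] {X : Set G} {C d : ℕ}
    (h : ∀ N > 0, {x ∈ X | x ^ N = 1}.Finite ∧ {x ∈ X | x ^ N = 1}.ncard ≤ C * N ^ d) (m : ℕ) :
    {x ∈ X | IsOfFinOrder x ∧ orderOf x ≤ m}.Finite ∧
      {x ∈ X | IsOfFinOrder x ∧ orderOf x ≤ m}.ncard ≤ C * m ^ (d + 1) := by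
  have hsub : {x ∈ X | IsOfFinOrder x ∧ orderOf x ≤ m} ⊆
      ⋃ N ∈ Finset.Icc 1 m, {x ∈ X | x ^ N = 1} := fun x ⟨hx, hfin, hord⟩ =>
    Set.mem_biUnion (Finset.mem_Icc.2 ⟨hfin.orderOf_pos, hord⟩) ⟨hx, pow_orderOf_eq_one x⟩
  have hfinite : (⋃ N ∈ Finset.Icc 1 m, {x ∈ X | x ^ N = 1}).Finite :=
    (Finset.finite_toSet _).biUnion fun N hN => (h N (Finset.mem_Icc.1 hN).1).1
  refine ⟨hfinite.subset hsub, ?_⟩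
  calc {x ∈ X | IsOfFinOrder x ∧ orderOf x ≤ m}.ncard
      ≤ ∑ N ∈ Finset.Icc 1 m, {x ∈ X | x ^ N = 1}.ncard :=
        (Set.ncard_le_ncard hsub hfinite).trans (Finset.set_ncard_biUnion_le _ _)
    _ ≤ ∑ _N ∈ Finset.Icc 1 m, C * m ^ d := by
        refine Finset.sum_le_sum fun N hN => ?_
        obtain ⟨hpos, hle⟩ := Finset.mem_Icc.1 hN
        exact (h N hpos).2.trans (by gcongr)
    _ = C * m ^ (d + 1) := by
        rw [Finset.sum_const, Nat.card_Icc, Nat.add_sub_cancel, smul_eq_mul]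
        ring

section Torus

variable {K : Type*} [Field K] {n : ℕ}

/-- Evaluation at a point of `X`, on the coordinate ring of `X`. -/
noncomputable def evalOn {X : Set (Torus K n)} {x : Torus K n} (hx : x ∈ X) :
    (Laurent K n ⧸ vanishingIdeal X) →ₐ[K] K :=
  Ideal.Quotient.liftₐ _ (evalAt x) fun _ hP => by
    simp only [vanishingIdeal, Submodule.mem_iInf] at hP
    exact hP x hx

/-- The `i`-th coordinate as an element of the coordinate ring of `X`. -/
noncomputable def coord (X : Set (Torus K n)) (i : Fin n) : Laurent K n ⧸ vanishingIdeal X :=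
  Ideal.Quotient.mk _ (AddMonoidAlgebra.single (Pi.single i 1) 1)

theorem evalOn_coord {X : Set (Torus K n)} {x : Torus K n} (hx : x ∈ X) (i : Fin n) :
    evalOn hx (coord X i) = x i := by
  have h : evalOn hx (coord X i) = evalAt x (AddMonoidAlgebra.single (Pi.single i 1) 1) := rfl
  rw [h, evalAt, AddMonoidAlgebra.lift_single, one_smul, monomialAt]
  simp only [MonoidHom.coe_mk, OneHom.coe_mk, toAdd_ofAdd]
  rw [Fintype.prod_eq_single i fun j hj => by simp [hj]]
  simp

theorem exists_ncard_pow_eq_one_le {X : Set (Torus K n)} {d : ℕ} (hd : dim X ≤ d) :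
    ∃ C : ℕ, ∀ N > 0, {x ∈ X | x ^ N = 1}.Finite ∧ {x ∈ X | x ^ N = 1}.ncard ≤ C * N ^ d := by
  obtain ⟨C, hC⟩ := exists_ncard_torsionValues_le (k := K) hd (coord X)
  refine ⟨C, fun N hN => ?_⟩
  let ι (x : Torus K n) (i : Fin n) : K := x i
  have hmaps : Set.MapsTo ι {x ∈ X | x ^ N = 1} (torsionValues K (coord X) N) :=
    fun x ⟨hx, hxN⟩ => ⟨funext fun i => congrArg Units.val (congrFun hxN i), evalOn hx,
      evalOn_coord hx⟩
  have hinj : Function.Injective ι := fun x y h => funext fun i => Units.ext (congrFun h i)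
  obtain ⟨hfin, hcard⟩ := hC N hN
  exact ⟨.of_injOn hmaps hinj.injOn hfin,
    (Set.ncard_le_ncard_of_injOn ι hmaps hinj.injOn hfin).trans hcard⟩

end Torus

end TorusTorsion

theorem proposition1p3_general {K : Type*} [Field K] {n : ℕ} (X : Set (TorusTorsion.Torus K n))
    (d : ℕ) (hd : TorusTorsion.dim X ≤ d) :
    ∃ C : ℝ, ∀ T : ℝ, 1 ≤ T →
      (TorusTorsion.torsionUpTo X T).Finite ∧
        ((TorusTorsion.torsionUpTo X T).ncard : ℝ) ≤ C * T ^ (d + 1) := by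
  obtain ⟨C, hC⟩ := TorusTorsion.exists_ncard_pow_eq_one_le hd
  refine ⟨C, fun T hT => ?_⟩
  have hT0 : 0 ≤ T := zero_le_one.trans hT
  have hfloor : TorusTorsion.torsionUpTo X T = {x ∈ X | IsOfFinOrder x ∧ orderOf x ≤ ⌊T⌋₊} := by
    ext x
    simp only [TorusTorsion.torsionUpTo, Set.mem_ofPred_eq, Nat.le_floor_iff hT0]
  obtain ⟨hfin, hcard⟩ := TorusTorsion.finite_orderOf_le_and_ncard_le hC ⌊T⌋₊
  refine hfloor ▸ ⟨hfin, ?_⟩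
  calc _ ≤ (C : ℝ) * (⌊T⌋₊ : ℝ) ^ (d + 1) := mod_cast hcard
    _ ≤ C * T ^ (d + 1) := by
        gcongr
        exact Nat.floor_le hT0

theorem proposition1p3 {K : Type*} [Field K] [IsAlgClosed K] {n : ℕ}
    (X : Set (TorusTorsion.Torus K n)) (hX : TorusTorsion.IsAlgebraic X)
    (d : ℕ) (hd : TorusTorsion.dim X = d) :
    ∃ C : ℝ, ∀ T : ℝ, 1 ≤ T →
      (TorusTorsion.torsionUpTo X T).Finite ∧
        ((TorusTorsion.torsionUpTo X T).ncard : ℝ) ≤ C * T ^ (d + 1) :=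
  proposition1p3_general X d hd.le
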